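/- Let $\Gamma$ be a finite simple graph with vertex set $\{1,\dots,N\}$ and let $A$ be the right-angled Artin group with generators $a_1,\dots,a_N$ and relations $a_ia_j=a_ja_i$ for all $i,j$ that are \emph{not} joined by an edge of $\Gamma$; below, "$a_i$ and $a_j$ do not commute" means that $i,j$ are joined by an edge. \textbf{Words.} Words are over the letters $a_i^{\pm1}$; two words are equivalent if they represent the same element of $A$. A word is \emph{reduced} if it has no subword $a_i^{\varepsilon}xa_i^{-\varepsilon}$ ($\varepsilon=\pm1$) in which all letters of $x$ commute with $a_i$. It is \emph{cyclically reduced} if every word obtained from it by a (possibly empty) sequence of cyclings (moving the first letter to the end) and commutations of neighbouring commuting letters is reduced. A reduced word is \emph{initially normal} if it is empty or the index of its first letter is at least the index of the first letter of every equivalent reduced word; a reduced word is \emph{normal} if all its suffixes are initially normal. A \emph{cyclic normal form} is a reduced, cyclically reduced word that is normal and all of whose cyclic conjugates (cyclic permutations) are normal. \textbf{Pilings.} An abstract piling is a family of $N$ words (the $a_i$-stacks, read from bottom to top) over $\{+,-,0\}$. For a word $w$, the abstract piling $\pi^\star(w)$ is built from the empty one by reading $w$ from left to right. When $a_i^{\varepsilon}$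 is read: if the $a_i$-stack does not end with the sign $-\varepsilon$, append the sign of $\varepsilon$ to the $a_i$-stack and $0$ to the $a_j$-stack for every $a_j$ that does not commute with $a_i$; if it ends with $-\varepsilon$, erase the last letter of the $a_i$-stack and of all those $a_j$-stacks. A \emph{piling} is an abstract piling of the form $\pi^\star(w)$. A piling $p$ is \emph{non-split} if the full subgraph of $\Gamma$ on the vertices $i$ whose stack contains a letter $+$ or $-$ is non-empty and connected. It is \emph{cyclically reduced} if no stack starts with $+$ and ends with $-$, or vice versa. It is \emph{pyramidal} if some stack contains a letter $+$ or $-$ and, $i$ being the smallest index of such a stack, every $a_j$-stack with $j\neq i$ is empty or starts with $0$. The word $\sigma^\star(p)$ is defined recursively: it is empty if $p$ is empty; otherwise let $i$ be the largest index such that the $a_i$-stack starts with $+$ or $-$, and put $\sigma^\star(p)=a_i^{\pm1}\sigma^\star(p_1)$, with exponent given by that sign, where $p_1$ is obtained from $p$ by removing the first letter of the $a_i$-stack and of the $a_j$-stack for every $a_j$ that does not commute with $a_i$. \textbf{Proposition.} If $p$ is a non-split, cyclically reduced, pyramidal piling, then the word $\sigma^\star(p)$ is a cyclic normal form; that is,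 it is reduced and cyclically reduced, it is normal, and all its cyclic conjugates are normal. -/

import Mathlib

namespace RAAG

/-- The right-angled Artin group on generators `a_i`, `i : Fin N`, defined by the simple graph `Γ`
with the convention that two generators commute exactly when they are NOT joined by an edge. -/
abbrev ArtinGroup {N : ℕ} (Γ : SimpleGraph (Fin N)) : Type :=
  PresentedGroup {r : FreeGroup (Fin N) |
    ∃ i j : Fin N, ¬ Γ.Adj i j ∧
      r = FreeGroup.of i * FreeGroup.of j * (FreeGroup.of i)⁻¹ * (FreeGroup.of j)⁻¹}

/-- A letter: `(i, true)` is `a_i`, and `(i, false)` is the inverse of `a_i`. -/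
abbrev Letter (N : ℕ) : Type := Fin N × Bool

/-- Words over the letters and their inverses. -/
abbrev Word (N : ℕ) : Type := List (Letter N)

/-- The element of the right-angled Artin group represented by a word. -/
def toGroup {N : ℕ} (Γ : SimpleGraph (Fin N)) (w : Word N) : ArtinGroup Γ :=
  PresentedGroup.mk _ (FreeGroup.mk w)

/-- A word is reduced if it has no subword `a_i^ε x a_i^{-ε}` such that all letters of `x` commute
with `a_i`. -/
def IsReduced {N : ℕ} (Γ : SimpleGraph (Fin N)) (w : Word N) : Prop :=
  ¬ ∃ (u x v : Word N) (i : Fin N) (e : Bool),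
    w = u ++ (i, e) :: x ++ (i, !e) :: v ∧ ∀ c ∈ x, ¬ Γ.Adj i c.1

/-- A reduced word is initially normal if it is trivial or the index of its first letter is at least
the index of the first letter of any equivalent reduced word. -/
def IsInitiallyNormal {N : ℕ} (Γ : SimpleGraph (Fin N)) (w : Word N) : Prop :=
  IsReduced Γ w ∧
    ∀ u : Word N, IsReduced Γ u → toGroup Γ u = toGroup Γ w →
      ∀ a ∈ w.head?, ∀ b ∈ u.head?, b.1 ≤ a.1

/-- A reduced word is normal if all its suffixes are initially normal. -/
def IsNormal {N : ℕ} (Γ : SimpleGraph (Fin N)) (w : Word N) : Prop :=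
  IsReduced Γ w ∧ ∀ v : Word N, v <:+ w → IsInitiallyNormal Γ v

/-- One elementary move on words: a cycling (the first letter is moved to the end) or a commutation
of two neighbouring letters. -/
inductive Move {N : ℕ} (Γ : SimpleGraph (Fin N)) : Word N → Word N → Prop
  | cycling (a : Letter N) (w : Word N) : Move Γ (a :: w) (w ++ [a])
  | commutation (u v : Word N) (a b : Letter N) (h : ¬ Γ.Adj a.1 b.1) :
      Move Γ (u ++ a :: b :: v) (u ++ b :: a :: v)

/-- A word is cyclically reduced if it is reduced and all words obtained from it by a sequence of
cyclings and commutations are reduced (the empty sequence gives the word itself). -/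
def IsCyclicallyReducedWord {N : ℕ} (Γ : SimpleGraph (Fin N)) (w : Word N) : Prop :=
  ∀ v : Word N, Relation.ReflTransGen (Move Γ) w v → IsReduced Γ v

/-- A cyclic normal form: a reduced and cyclically reduced word which is normal and all of whose
cyclic conjugates are normal. -/
def IsCyclicNormalForm {N : ℕ} (Γ : SimpleGraph (Fin N)) (w : Word N) : Prop :=
  IsReduced Γ w ∧ IsCyclicallyReducedWord Γ w ∧ IsNormal Γ w ∧
    ∀ v : Word N, v ~r w → IsNormal Γ v

/-- An abstract piling: for each generator a stack, that is, a word over the alphabet `{+, -, 0}`,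
here `SignType = {1, -1, 0}`. The head of the list is the bottom of the stack. -/
abbrev AbstractPiling (N : ℕ) : Type := Fin N → List SignType

/-- The bead on its own stick of a letter. -/
def bead : Bool → SignType
  | true => 1
  | false => -1

/-- The effect of reading one letter `a = a_i^ε`. If the `a_i`-stack ends with `-ε`, the last beads
of the `a_i`-stack and of the stacks of all generators that do not commute with `a_i` are erased.
Otherwise `ε` is appended to the `a_i`-stack and `0` to the stacks of all generators that do not
commute with `a_i`. -/
def addLetter {N : ℕ} (Γ : SimpleGraph (Fin N)) [DecidableRel Γ.Adj]
    (p : AbstractPiling N) (a : Letter N) : AbstractPiling N :=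
  if (p a.1).getLast? = some (-bead a.2) then
    fun j => if j = a.1 ∨ Γ.Adj a.1 j then (p j).dropLast else p j
  else
    fun j => if j = a.1 then p j ++ [bead a.2] else if Γ.Adj a.1 j then p j ++ [0] else p j

/-- The map `π*` from words to abstract pilings. -/
def piStar {N : ℕ} (Γ : SimpleGraph (Fin N)) [DecidableRel Γ.Adj] (w : Word N) :
    AbstractPiling N :=
  w.foldl (addLetter Γ) (fun _ => [])

/-- A piling is an abstract piling in the image of `π*`. -/
def IsPiling {N : ℕ} (Γ : SimpleGraph (Fin N)) [DecidableRel Γ.Adj]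
    (p : AbstractPiling N) : Prop :=
  ∃ w : Word N, piStar Γ w = p

/-- The set of indices `i` such that the `a_i`-stack contains a bead `+` or `-`. -/
def support {N : ℕ} (p : AbstractPiling N) : Set (Fin N) :=
  {i | ∃ s ∈ p i, s ≠ 0}

/-- A piling is non-split if the full subgraph of `Γ` on its support is connected (in particular
the piling is not trivial). -/
def IsNonSplit {N : ℕ} (Γ : SimpleGraph (Fin N)) (p : AbstractPiling N) : Prop :=
  (Γ.induce (support p)).Connected

/-- No cyclic reduction is possible: no stack starts with `+` and ends with `-`, or vice versa. -/
def IsCyclicallyReduced {N : ℕ} (p : AbstractPiling N) : Prop :=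
  ¬ ∃ (i : Fin N) (s : SignType),
    s ≠ 0 ∧ (p i).head? = some s ∧ (p i).getLast? = some (-s)

/-- A piling is pyramidal if, `i` being the smallest index whose stack contains a bead `+` or `-`,
every stack other than the `a_i`-stack is empty or starts with `0`. -/
def IsPyramidal {N : ℕ} (p : AbstractPiling N) : Prop :=
  ∃ i : Fin N, IsLeast (support p) i ∧ ∀ j : Fin N, j ≠ i → p j = [] ∨ (p j).head? = some 0

/-- The indices of the stacks that start with `+` or `-`. -/
def bottom {N : ℕ} (p : AbstractPiling N) : Finset (Fin N) :=
  Finset.univ.filter fun i => (p i).head? = some 1 ∨ (p i).head? = some (-1)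

/-- Removal of the bottom `a_i`-tile: the first bead is removed from the `a_i`-stack and from the
stacks of all generators that do not commute with `a_i`. -/
def removeBottom {N : ℕ} (Γ : SimpleGraph (Fin N)) [DecidableRel Γ.Adj]
    (p : AbstractPiling N) (i : Fin N) : AbstractPiling N :=
  fun j => if j = i ∨ Γ.Adj i j then (p j).tail else p j

/-- The number of beads `+` and `-`. -/
def size {N : ℕ} (p : AbstractPiling N) : ℕ :=
  ∑ i, (p i).countP (fun s => s ≠ 0)

theorem size_removeBottom_lt {N : ℕ} (Γ : SimpleGraph (Fin N)) [DecidableRel Γ.Adj]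
    (p : AbstractPiling N) (i : Fin N) (hi : i ∈ bottom p) :
    size (removeBottom Γ p i) < size p := by
  unfold size
  refine Finset.sum_lt_sum (fun j _ => ?_) ⟨i, Finset.mem_univ i, ?_⟩
  · unfold removeBottom
    split
    · exact (List.tail_sublist _).countP_le
    · exact le_rfl
  · simp only [bottom, Finset.mem_filter] at hi
    simp only [removeBottom, true_or, if_true]
    cases h : p i with
    | nil => simp [h] at hi
    | cons s l =>
      have hs : s ≠ 0 := by
        rw [h] at hi
        rcases hi.2 with h1 | h1 <;> simp at h1 <;> rw [h1] <;> decide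
      simp [hs]

/-- The word `σ*(p)` read off from `p`: as long as possible, take the largest index `i` such that
the `a_i`-stack starts with `+` or `-`, write the corresponding letter, and remove the bottom
`a_i`-tile. -/
def sigmaStar {N : ℕ} (Γ : SimpleGraph (Fin N)) [DecidableRel Γ.Adj]
    (p : AbstractPiling N) : Word N :=
  if h : (bottom p).Nonempty then
    ((bottom p).max' h, decide ((p ((bottom p).max' h)).head? = some 1)) ::
      sigmaStar Γ (removeBottom Γ p ((bottom p).max' h))
  else []
termination_by size p
decreasing_by exact size_removeBottom_lt Γ p _ (Finset.max'_mem _ h)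

end RAAG

namespace RAAG

/-! Stacks are also built without cancellation (`stack`). A word is reduced iff no stack has
adjacent opposite signs (`isReduced_iff`), and every piling is the stack family of a reduced word.
The word read off by `sigmaStar` has the stacks of the piling and is greedy: each suffix begins with
the largest index whose stack starts with a sign (`sigmaStar_stack`).

The group acts on reduced pilings by reading letters, so equivalent reduced words have equal stacks;
hence greedy reduced words are normal (`IsGreedy.isNormal`).

Greediness survives rotation (`IsGreedy.rotate`): a sign at the bottom of a suffix of the rotated
word is either already at the bottom of a suffix of the original word, or at the bottom of the whole
piling. In the latter case it lies on the apex stack, whose index is minimal. Reducedness of all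
cyclic conjugates holds because the stacks, read cyclically, have no adjacent opposite signs, a
property that cyclings and commutations preserve. -/

theorem toGroup_cons {N : ℕ} (Γ : SimpleGraph (Fin N)) (a : Letter N) (w : Word N) :
    toGroup Γ (a :: w) = toGroup Γ [a] * toGroup Γ w := by
  unfold toGroup
  rw [← map_mul, FreeGroup.mul_mk]
  rfl

section Stacks

variable {N : ℕ} (Γ : SimpleGraph (Fin N)) [DecidableRel Γ.Adj]

/-! ### Stacks of a word, without cancellation -/

/-- The bead, if any, that a letter puts on the `a_k`-stick when nothing is cancelled. -/
def mark (k : Fin N) (a : Letter N) : Option SignType :=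
  if k = a.1 then some (bead a.2) else if Γ.Adj a.1 k then some 0 else none

/-- The `a_k`-stack of a word, built without any cancellation. -/
def stack (k : Fin N) (w : Word N) : List SignType :=
  w.filterMap (mark Γ k)

/-- Two beads are compatible if they are not opposite signs. -/
def Compatible (s t : SignType) : Prop := s ≠ 0 → t ≠ -s

variable {Γ}

theorem bead_ne_zero (e : Bool) : bead e ≠ 0 := by cases e <;> decide

theorem bead_not (e : Bool) : bead (!e) = -bead e := by cases e <;> decide

theorem bead_injective : Function.Injective bead := by decide

theorem mark_self (k : Fin N) (e : Bool) : mark Γ k (k, e) = some (bead e) := by simp [mark]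

theorem mark_of_adj {k : Fin N} {a : Letter N} (h : Γ.Adj a.1 k) : mark Γ k a = some 0 := by
  have : k ≠ a.1 := h.ne'
  simp [mark, this, h]

theorem mark_of_not {k : Fin N} {a : Letter N} (h : ¬ (k = a.1 ∨ Γ.Adj a.1 k)) :
    mark Γ k a = none := by
  push Not at h
  simp [mark, h.1, h.2]

theorem eq_of_mark_eq_some {k : Fin N} {a : Letter N} {s : SignType} (h : mark Γ k a = some s)
    (hs : s ≠ 0) : ∃ e, a = (k, e) ∧ bead e = s := by
  obtain ⟨i, e⟩ := a
  unfold mark at h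
  split_ifs at h with h1 h2
  · exact ⟨e, by simp_all, by simpa using h⟩
  · simp at h; exact absurd h.symm hs

theorem ne_and_not_adj_of_mark_eq_none {k : Fin N} {a : Letter N} (h : mark Γ k a = none) :
    k ≠ a.1 ∧ ¬ Γ.Adj a.1 k := by
  unfold mark at h
  split_ifs at h with h1 h2
  exact ⟨h1, h2⟩

@[simp] theorem stack_nil (k : Fin N) : stack Γ k [] = [] := rfl

@[simp] theorem stack_append (k : Fin N) (u v : Word N) :
    stack Γ k (u ++ v) = stack Γ k u ++ stack Γ k v := List.filterMap_append

theorem stack_cons_self (k : Fin N) (e : Bool) (w : Word N) :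
    stack Γ k ((k, e) :: w) = bead e :: stack Γ k w :=
  List.filterMap_cons_some (mark_self k e)

theorem stack_cons_of_adj {k : Fin N} {a : Letter N} (h : Γ.Adj a.1 k) (w : Word N) :
    stack Γ k (a :: w) = 0 :: stack Γ k w :=
  List.filterMap_cons_some (mark_of_adj h)

theorem stack_cons_of_not {k : Fin N} {a : Letter N} (h : ¬ (k = a.1 ∨ Γ.Adj a.1 k))
    (w : Word N) : stack Γ k (a :: w) = stack Γ k w :=
  List.filterMap_cons_none (mark_of_not h)

theorem stack_eq_nil_iff {k : Fin N} {w : Word N} :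
    stack Γ k w = [] ↔ ∀ a ∈ w, mark Γ k a = none := List.filterMap_eq_nil_iff

/-- A nonzero bead of a stack comes from a letter of the word. -/
theorem exists_of_stack_eq {k : Fin N} {w : Word N} {l₁ l₂ : List SignType} {s : SignType}
    (h : stack Γ k w = l₁ ++ s :: l₂) (hs : s ≠ 0) :
    ∃ (x y : Word N) (e : Bool), w = x ++ (k, e) :: y ∧ bead e = s ∧
      stack Γ k x = l₁ ∧ stack Γ k y = l₂ := by
  obtain ⟨u, v, rfl, hu, hv⟩ := List.filterMap_eq_append_iff.1 h
  obtain ⟨x, a, y, rfl, hx, ha, hy⟩ := List.filterMap_eq_cons_iff.1 hv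
  obtain ⟨e, rfl, he⟩ := eq_of_mark_eq_some ha hs
  refine ⟨u ++ x, y, e, by simp, he, ?_, hy⟩
  rw [stack_append, stack_eq_nil_iff.2 hx, List.append_nil]
  exact hu

theorem exists_of_head?_stack {k : Fin N} {w : Word N} {s : SignType}
    (h : (stack Γ k w).head? = some s) (hs : s ≠ 0) :
    ∃ (x y : Word N) (e : Bool), w = x ++ (k, e) :: y ∧ bead e = s ∧ stack Γ k x = [] := by
  obtain ⟨l, hl⟩ := List.head?_eq_some_iff.1 h
  obtain ⟨x, y, e, hw, he, hx, -⟩ := exists_of_stack_eq (l₁ := []) hl hs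
  exact ⟨x, y, e, hw, he, hx⟩

theorem exists_of_getLast?_stack {k : Fin N} {w : Word N} {s : SignType}
    (h : (stack Γ k w).getLast? = some s) (hs : s ≠ 0) :
    ∃ (x y : Word N) (e : Bool), w = x ++ (k, e) :: y ∧ bead e = s ∧ stack Γ k y = [] := by
  obtain ⟨l, hl⟩ := List.getLast?_eq_some_iff.1 h
  obtain ⟨x, y, e, hw, he, -, hy⟩ := exists_of_stack_eq (l₂ := []) hl hs
  exact ⟨x, y, e, hw, he, hy⟩

theorem mem_support_stack_iff {k : Fin N} {w : Word N} :
    k ∈ support (fun j => stack Γ j w) ↔ ∃ e, (k, e) ∈ w := by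
  constructor
  · rintro ⟨s, hs, hs0⟩
    obtain ⟨l₁, l₂, h⟩ := List.append_of_mem hs
    obtain ⟨x, y, e, rfl, -⟩ := exists_of_stack_eq h hs0
    exact ⟨e, by simp⟩
  · rintro ⟨e, he⟩
    exact ⟨bead e, List.mem_filterMap.2 ⟨_, he, mark_self k e⟩, bead_ne_zero e⟩

/-- If no letter of `x` meets the `a_k`-stick, then the stacks of the neighbours of `k` only
contain zeros. -/
theorem zero_cons_stack {k j : Fin N} {x : Word N} (hx : stack Γ k x = []) (h : Γ.Adj k j) :
    0 :: stack Γ j x = stack Γ j x ++ [0] := by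
  induction x with
  | nil => rfl
  | cons a x ih =>
    rw [stack_eq_nil_iff] at hx
    have ih := ih (stack_eq_nil_iff.2 fun b hb => hx b (List.mem_cons_of_mem _ hb))
    by_cases h1 : Γ.Adj a.1 j
    · rw [stack_cons_of_adj h1, List.cons_append, ← ih]
    · have h2 : j ≠ a.1 := by
        rintro rfl
        exact (ne_and_not_adj_of_mark_eq_none (hx a List.mem_cons_self)).2 h.symm
      rw [stack_cons_of_not (by tauto), ih]

theorem stack_insert_of_not {k j : Fin N} (x y : Word N) (e : Bool)
    (h : ¬ (j = k ∨ Γ.Adj k j)) : stack Γ j (x ++ (k, e) :: y) = stack Γ j (x ++ y) := by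
  rw [stack_append, stack_cons_of_not h, stack_append]

theorem stack_insert_bottom_of_adj {k j : Fin N} {x : Word N} (y : Word N) (e : Bool)
    (hx : stack Γ k x = []) (h : Γ.Adj k j) :
    stack Γ j (x ++ (k, e) :: y) = 0 :: stack Γ j (x ++ y) := by
  rw [stack_append, stack_cons_of_adj h, stack_append, ← List.cons_append, zero_cons_stack hx h]
  simp

theorem stack_insert_top_of_adj {k j : Fin N} (x : Word N) {y : Word N} (e : Bool)
    (hy : stack Γ k y = []) (h : Γ.Adj k j) :
    stack Γ j (x ++ (k, e) :: y) = stack Γ j (x ++ y) ++ [0] := by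
  rw [stack_append, stack_cons_of_adj h, stack_append, zero_cons_stack hy h]
  simp

/-- Removing a bottom tile from the stacks of a word. -/
theorem removeBottom_stack {k : Fin N} {x : Word N} (y : Word N) (e : Bool)
    (hx : stack Γ k x = []) :
    removeBottom Γ (fun j => stack Γ j (x ++ (k, e) :: y)) k = fun j => stack Γ j (x ++ y) := by
  funext j
  simp only [removeBottom]
  split_ifs with h
  · rcases h with rfl | h
    · simp [stack_cons_self, hx]
    · rw [stack_insert_bottom_of_adj y e hx h, List.tail_cons]
  · exact stack_insert_of_not x y e h

/-- Adding a letter that cancels against a top tile. -/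
theorem addLetter_stack_of_cancel {k : Fin N} (x : Word N) {y : Word N} {e : Bool}
    (hy : stack Γ k y = []) :
    addLetter Γ (fun j => stack Γ j (x ++ (k, !e) :: y)) (k, e) =
      fun j => stack Γ j (x ++ y) := by
  have h : (stack Γ k (x ++ (k, !e) :: y)).getLast? = some (-bead e) := by
    simp [stack_cons_self, hy, bead_not]
  unfold addLetter
  simp only [h, if_true]
  funext j
  split_ifs with h
  · rcases h with rfl | h
    · simp [stack_cons_self, hy]
    · rw [stack_insert_top_of_adj x _ hy h, List.dropLast_concat]
  · exact stack_insert_of_not x y _ h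

/-- Adding a letter that does not cancel. -/
theorem addLetter_stack_of_not_cancel {w : Word N} {a : Letter N}
    (h : (stack Γ a.1 w).getLast? ≠ some (-bead a.2)) :
    addLetter Γ (fun j => stack Γ j w) a = fun j => stack Γ j (w ++ [a]) := by
  unfold addLetter
  simp only [h, if_false]
  funext j
  split_ifs with h1 h2
  · subst h1
    rw [stack_append]
    exact congrArg _ (stack_cons_self a.1 a.2 []).symm
  · rw [stack_append, stack_cons_of_adj h2, stack_nil]
  · rw [stack_append, stack_cons_of_not (by tauto), stack_nil, List.append_nil]

/-! ### Reducedness in terms of stacks -/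

/-- A word is reduced exactly when no stack has two consecutive opposite signs. -/
theorem isReduced_iff {w : Word N} :
    IsReduced Γ w ↔ ∀ k, (stack Γ k w).IsChain Compatible := by
  constructor
  · intro h k
    rw [List.isChain_iff_forall_rel_of_append_cons_cons]
    intro s t l₁ l₂ hl hs ht
    obtain ⟨u, v, e, rfl, he, -, hv⟩ := exists_of_stack_eq hl hs
    obtain ⟨x, y, f, rfl, hf, hx, -⟩ := exists_of_stack_eq (l₁ := []) hv (by simpa [ht] using hs)
    have : f = !e := bead_injective (by rw [hf, ht, bead_not, he])
    subst this
    refine h ⟨u, x, y, k, e, by simp, fun c hc hadj => ?_⟩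
    exact (ne_and_not_adj_of_mark_eq_none (stack_eq_nil_iff.1 hx c hc)).2 hadj.symm
  · rintro h ⟨u, x, v, i, e, rfl, hx⟩
    -- A further letter of generator `i` inside `x` must carry the same sign, so it takes over the
    -- role of the initial letter; all other letters of `x` miss the `i`-stick.
    have key : ∀ (x : Word N), (∀ c ∈ x, ¬ Γ.Adj i c.1) → ∀ e : Bool,
        (stack Γ i ((i, e) :: x ++ (i, !e) :: v)).IsChain Compatible → False := by
      intro x
      induction x with
      | nil =>
        intro _ e h
        rw [List.cons_append, List.nil_append, stack_cons_self, stack_cons_self] at h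
        exact (List.isChain_cons_cons.1 h).1 (bead_ne_zero e) (bead_not e)
      | cons c x ih =>
        intro hx e h
        have ih := ih fun d hd => hx d (List.mem_cons_of_mem _ hd)
        have hc : ¬ Γ.Adj c.1 i := fun h => hx c List.mem_cons_self h.symm
        obtain ⟨j, f⟩ := c
        by_cases hj : j = i
        · subst hj
          rw [List.cons_append, List.cons_append, stack_cons_self, stack_cons_self] at h
          have h1 := List.isChain_cons_cons.1 h
          have hfe : f = e := by
            by_contra hne
            have : f = !e := by cases e <;> cases f <;> simp_all
            exact h1.1 (bead_ne_zero e) (by rw [this, bead_not])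
          subst hfe
          exact ih f (by rw [List.cons_append, stack_cons_self]; exact h1.2)
        · refine ih e ?_
          rw [List.cons_append, stack_cons_self] at h ⊢
          rwa [List.cons_append, stack_cons_of_not (by simp only; tauto)] at h
    have h1 := h i
    rw [List.append_assoc, stack_append] at h1
    exact key x hx e h1.right_of_append

theorem IsReduced.of_append_left {u v : Word N} (h : IsReduced Γ (u ++ v)) : IsReduced Γ u := by
  rw [isReduced_iff] at h ⊢
  intro k
  have := h k
  rw [stack_append] at this
  exact this.left_of_append

theorem IsReduced.of_append_right {u v : Word N} (h : IsReduced Γ (u ++ v)) : IsReduced Γ v := by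
  rw [isReduced_iff] at h ⊢
  intro k
  have := h k
  rw [stack_append] at this
  exact this.right_of_append

/-- Only the stack of the new letter gains a sign; the other stacks gain at most a zero, which is
compatible with everything. -/
theorem isReduced_append_singleton_iff {w : Word N} {a : Letter N} (hw : IsReduced Γ w) :
    IsReduced Γ (w ++ [a]) ↔ (stack Γ a.1 w).getLast? ≠ some (-bead a.2) := by
  rw [isReduced_iff] at hw ⊢
  obtain ⟨i, e⟩ := a
  constructor
  · intro h hl
    have h1 := h i
    rw [stack_append, stack_cons_self, stack_nil, List.isChain_append] at h1
    exact h1.2.2 _ hl _ rfl (by simpa using bead_ne_zero e) (by simp)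
  · intro h k
    rw [stack_append, List.isChain_append]
    refine ⟨hw k, ?_, ?_⟩
    · by_cases h1 : k = i ∨ Γ.Adj i k
      · rcases h1 with rfl | h1
        · simp [stack_cons_self]
        · simp [stack_cons_of_adj (a := (i, e)) h1]
      · rw [stack_cons_of_not h1]; simp
    · intro s hs t ht hs0
      by_cases h1 : k = i ∨ Γ.Adj i k
      · rcases h1 with rfl | h1
        · rintro rfl
          simp [stack_cons_self] at ht
          apply h
          rw [show (stack Γ k w).getLast? = some s from hs, ht, neg_neg]
        · simp [stack_cons_of_adj (a := (i, e)) h1] at ht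
          subst ht
          intro h0
          exact hs0 (by simpa using h0.symm)
      · rw [stack_cons_of_not h1] at ht; simp at ht

/-- Erasing a top tile of a reduced word gives a reduced word. -/
theorem IsReduced.erase_top {k : Fin N} {x y : Word N} {e : Bool} (hy : stack Γ k y = [])
    (h : IsReduced Γ (x ++ (k, e) :: y)) : IsReduced Γ (x ++ y) := by
  rw [isReduced_iff] at h ⊢
  intro j
  have hj := h j
  by_cases h1 : j = k ∨ Γ.Adj k j
  · rcases h1 with rfl | h1
    · rw [stack_append] at hj ⊢
      rw [hy, List.append_nil]
      exact hj.left_of_append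
    · rw [stack_insert_top_of_adj x e hy h1] at hj
      exact hj.left_of_append
  · rwa [stack_insert_of_not x y e h1] at hj

/-! ### Pilings and the group action -/

variable (Γ) in
/-- The abstract pilings that are the stacks of a reduced word. -/
def IsReducedPiling (p : AbstractPiling N) : Prop :=
  ∃ w : Word N, IsReduced Γ w ∧ (fun j => stack Γ j w) = p

theorem isReducedPiling_empty : IsReducedPiling Γ (fun _ => []) :=
  ⟨[], isReduced_iff.2 fun _ => by simp, rfl⟩

/-- If the new letter cancels, the letters after its partner miss the stick, so the partner is a top
tile and can be erased. -/
theorem IsReducedPiling.addLetter {p : AbstractPiling N} (hp : IsReducedPiling Γ p)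
    (a : Letter N) : IsReducedPiling Γ (addLetter Γ p a) := by
  obtain ⟨w, hw, rfl⟩ := hp
  by_cases h : (stack Γ a.1 w).getLast? = some (-bead a.2)
  · obtain ⟨x, y, e, rfl, he, hy⟩ :=
      exists_of_getLast?_stack h (by simpa using bead_ne_zero a.2)
    obtain rfl : e = !a.2 := bead_injective (by rw [he, bead_not])
    exact ⟨x ++ y, hw.erase_top hy, (addLetter_stack_of_cancel x hy).symm⟩
  · exact ⟨w ++ [a], (isReduced_append_singleton_iff hw).2 h,
      (addLetter_stack_of_not_cancel h).symm⟩

theorem IsPiling.isReducedPiling {p : AbstractPiling N} (hp : IsPiling Γ p) :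
    IsReducedPiling Γ p := by
  obtain ⟨w, rfl⟩ := hp
  have key : ∀ (w : Word N) (q : AbstractPiling N), IsReducedPiling Γ q →
      IsReducedPiling Γ (w.foldl (RAAG.addLetter Γ) q) := by
    intro w
    induction w with
    | nil => exact fun q hq => hq
    | cons a w ih => exact fun q hq => ih _ (hq.addLetter a)
  exact key w _ isReducedPiling_empty

theorem piStar_of_isReduced {w : Word N} (hw : IsReduced Γ w) :
    piStar Γ w = fun j => stack Γ j w := by
  induction w using List.reverseRecOn with
  | nil => rfl
  | append_singleton w a ih =>
    have hw' := hw.of_append_left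
    rw [piStar, List.foldl_append]
    change addLetter Γ (piStar Γ w) a = _
    rw [ih hw', addLetter_stack_of_not_cancel ((isReduced_append_singleton_iff hw').1 hw)]

theorem addLetter_addLetter_inv {p : AbstractPiling N} (hp : IsReducedPiling Γ p)
    (i : Fin N) (e : Bool) : addLetter Γ (addLetter Γ p (i, e)) (i, !e) = p := by
  obtain ⟨w, hw, rfl⟩ := hp
  by_cases h : (stack Γ i w).getLast? = some (-bead e)
  · obtain ⟨x, y, f, rfl, hf, hy⟩ := exists_of_getLast?_stack h (by simpa using bead_ne_zero e)
    obtain rfl : f = !e := bead_injective (by rw [hf, bead_not])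
    rw [addLetter_stack_of_cancel x hy, addLetter_stack_of_not_cancel]
    · funext j
      rw [stack_append]
      by_cases h1 : j = i ∨ Γ.Adj i j
      · rcases h1 with rfl | h1
        · simp [stack_cons_self, hy]
        · rw [stack_insert_top_of_adj x _ hy h1, stack_cons_of_adj (a := (i, !e)) h1, stack_nil]
      · rw [stack_insert_of_not x y _ h1, stack_cons_of_not h1, stack_nil, List.append_nil]
    -- Reducedness is essential: the bead under the erased one is not its opposite, so the second
    -- letter is appended rather than cancelled.
    · have := isReduced_iff.1 hw i
      rw [stack_append, stack_cons_self, hy, List.isChain_append] at this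
      rw [stack_append, hy, List.append_nil]
      intro hl
      refine this.2.2 _ hl _ rfl ?_ ?_
      · simpa using bead_ne_zero (!e)
      · simp
  · rw [addLetter_stack_of_not_cancel h]
    have := addLetter_stack_of_cancel (Γ := Γ) (k := i) w (y := []) (e := !e) rfl
    simpa using this

/-- In the stacks of a word, the neighbours of a top tile have a zero on top. -/
theorem IsReducedPiling.getLast?_of_adj {p : AbstractPiling N} (hp : IsReducedPiling Γ p)
    {i j : Fin N} {s : SignType} (h : (p i).getLast? = some s) (hs : s ≠ 0) (hij : Γ.Adj i j) :
    (p j).dropLast ++ [0] = p j := by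
  obtain ⟨w, -, rfl⟩ := hp
  obtain ⟨x, y, e, rfl, -, hy⟩ := exists_of_getLast?_stack h hs
  simp only [stack_insert_top_of_adj x e hy hij, List.dropLast_concat]

theorem addLetter_apply (p : AbstractPiling N) (a : Letter N) (j : Fin N) :
    addLetter Γ p a j =
      if j = a.1 ∨ Γ.Adj a.1 j then
        if (p a.1).getLast? = some (-bead a.2) then (p j).dropLast
        else p j ++ [if j = a.1 then bead a.2 else 0]
      else p j := by
  unfold addLetter
  by_cases h : (p a.1).getLast? = some (-bead a.2) <;> by_cases h1 : j = a.1 <;>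
    by_cases h2 : Γ.Adj a.1 j <;> simp [h, h1, h2]

/-- Reading two commuting letters in either order has the same effect. -/
theorem addLetter_comm {p : AbstractPiling N} (hp : IsReducedPiling Γ p) {a b : Letter N}
    (hne : a.1 ≠ b.1) (hab : ¬ Γ.Adj a.1 b.1) :
    addLetter Γ (addLetter Γ p a) b = addLetter Γ (addLetter Γ p b) a := by
  have hba : ¬ Γ.Adj b.1 a.1 := fun h => hab h.symm
  have hb : addLetter Γ p a b.1 = p b.1 := by
    rw [addLetter_apply, if_neg (by simp [hab, hne.symm])]
  have ha : addLetter Γ p b a.1 = p a.1 := by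
    rw [addLetter_apply, if_neg (by simp [hba, hne])]
  have za : (p a.1).getLast? = some (-bead a.2) → ∀ j, Γ.Adj a.1 j →
      (p j).dropLast ++ [0] = p j := fun h j hj =>
    hp.getLast?_of_adj h (by simpa using bead_ne_zero a.2) hj
  have zb : (p b.1).getLast? = some (-bead b.2) → ∀ j, Γ.Adj b.1 j →
      (p j).dropLast ++ [0] = p j := fun h j hj =>
    hp.getLast?_of_adj h (by simpa using bead_ne_zero b.2) hj
  funext j
  rw [addLetter_apply _ b, hb, addLetter_apply _ a, addLetter_apply _ a, ha, addLetter_apply _ b]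
  by_cases ja : j = a.1
  · subst ja
    simp [hne, hba]
  by_cases jb : j = b.1
  · subst jb
    simp [hne.symm, hab]
  by_cases h3 : Γ.Adj a.1 j <;> by_cases h4 : Γ.Adj b.1 j <;> simp only [ja, jb, h3, h4] <;> simp
  -- On a stack met by both letters, if one cancels and the other does not, erasing and appending a
  -- zero undo each other, since the top bead is already zero.
  split_ifs with h1 h2 h2
  · rfl
  · rw [List.dropLast_concat, zb h1 j h4]
  · rw [List.dropLast_concat, za h2 j h3]
  · rfl

variable (Γ) in
/-- The permutation of the set of pilings given by reading the inverse of a generator. -/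
def generatorPerm (i : Fin N) : Equiv.Perm {p : AbstractPiling N // IsReducedPiling Γ p} where
  toFun p := ⟨addLetter Γ p.1 (i, false), p.2.addLetter _⟩
  invFun p := ⟨addLetter Γ p.1 (i, true), p.2.addLetter _⟩
  left_inv p := Subtype.ext (addLetter_addLetter_inv p.2 i false)
  right_inv p := Subtype.ext (addLetter_addLetter_inv p.2 i true)

theorem generatorPerm_comm {i j : Fin N} (h : ¬ Γ.Adj i j) :
    generatorPerm Γ i * generatorPerm Γ j = generatorPerm Γ j * generatorPerm Γ i := by
  by_cases hij : i = j
  · rw [hij]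
  · ext1 p
    exact Subtype.ext (addLetter_comm p.2 (a := (j, false)) (b := (i, false))
      (fun h => hij h.symm) fun hji => h hji.symm)

variable (Γ) in
/-- The action of the right-angled Artin group on the set of pilings. -/
def pilingAction :
    ArtinGroup Γ →* Equiv.Perm {p : AbstractPiling N // IsReducedPiling Γ p} :=
  PresentedGroup.toGroup (f := generatorPerm Γ) (by
    rintro r ⟨i, j, hij, rfl⟩
    simp only [map_mul, map_inv, FreeGroup.lift_apply_of]
    rw [generatorPerm_comm hij]
    group)

/-- Reading from left to right is a right action; the inverses turn it into a left action. -/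
theorem pilingAction_letter (a : Letter N) (p : {p : AbstractPiling N // IsReducedPiling Γ p}) :
    (((pilingAction Γ (toGroup Γ [a]))⁻¹ p : _) : AbstractPiling N) = addLetter Γ p.1 a := by
  obtain ⟨i, e⟩ := a
  have hof : pilingAction Γ (toGroup Γ [(i, true)]) = generatorPerm Γ i :=
    PresentedGroup.toGroup.of _
  cases e
  · have : toGroup Γ [(i, false)] = (toGroup Γ [(i, true)])⁻¹ := by
      unfold toGroup
      rw [← map_inv, FreeGroup.inv_mk]
      rfl
    rw [this, map_inv, inv_inv, hof]
    rfl
  · rw [hof]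
    rfl

theorem pilingAction_word (w : Word N) (p : {p : AbstractPiling N // IsReducedPiling Γ p}) :
    (((pilingAction Γ (toGroup Γ w))⁻¹ p : _) : AbstractPiling N) =
      w.foldl (addLetter Γ) p.1 := by
  induction w generalizing p with
  | nil =>
    have : toGroup Γ ([] : Word N) = 1 := map_one _
    rw [this]
    simp
  | cons a w ih =>
    rw [toGroup_cons, map_mul, mul_inv_rev, Equiv.Perm.mul_apply, ih, pilingAction_letter]
    rfl

/-- Equivalent words have the same piling. -/
theorem piStar_eq_of_toGroup_eq {u w : Word N} (h : toGroup Γ u = toGroup Γ w) :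
    piStar Γ u = piStar Γ w := by
  have hu := pilingAction_word u ⟨_, isReducedPiling_empty (Γ := Γ)⟩
  have hw := pilingAction_word w ⟨_, isReducedPiling_empty (Γ := Γ)⟩
  rw [h, hw] at hu
  exact hu.symm

/-! ### Greedy words and normality -/

variable (Γ) in
/-- Every suffix starts with the largest index of a bottom tile of its stacks. -/
def IsGreedy (w : Word N) : Prop :=
  ∀ (a : Letter N) (v : Word N), a :: v <:+ w → ∀ (k : Fin N) (s : SignType), s ≠ 0 →
    (stack Γ k (a :: v)).head? = some s → k ≤ a.1

/-- The first letter of an equivalent reduced word is a sign at the bottom of its stack, and the two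
words share their stacks. -/
theorem IsGreedy.isNormal {w : Word N} (hg : IsGreedy Γ w) (hw : IsReduced Γ w) :
    IsNormal Γ w := by
  refine ⟨hw, fun v hv => ?_⟩
  have hvr : IsReduced Γ v := by
    obtain ⟨u, rfl⟩ := hv
    exact hw.of_append_right
  refine ⟨hvr, fun u hu huv a ha b hb => ?_⟩
  obtain ⟨v, rfl⟩ := List.head?_eq_some_iff.1 ha
  obtain ⟨u, rfl⟩ := List.head?_eq_some_iff.1 hb
  have h := piStar_eq_of_toGroup_eq huv
  rw [piStar_of_isReduced hu, piStar_of_isReduced hvr] at h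
  refine hg a v hv b.1 (bead b.2) (bead_ne_zero _) ?_
  rw [← congrFun h b.1]
  exact congrArg List.head? (stack_cons_self b.1 b.2 u)

theorem mem_bottom_iff {p : AbstractPiling N} {i : Fin N} :
    i ∈ bottom p ↔ ∃ s, s ≠ 0 ∧ (p i).head? = some s := by
  simp only [bottom, Finset.mem_filter, Finset.mem_univ, true_and]
  constructor
  · rintro (h | h)
    · exact ⟨1, by decide, h⟩
    · exact ⟨-1, by decide, h⟩
  · rintro ⟨s, hs, h⟩
    rw [h]
    revert hs
    cases s <;> decide

/-- The word read off from the stacks of a word has the same stacks, and it is greedy. -/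
theorem sigmaStar_stack (w : Word N) :
    (∀ k, stack Γ k (sigmaStar Γ fun j => stack Γ j w) = stack Γ k w) ∧
      IsGreedy Γ (sigmaStar Γ fun j => stack Γ j w) := by
  induction hn : w.length using Nat.strong_induction_on generalizing w with
  | _ n ih =>
    by_cases hb : (bottom fun j => stack Γ j w).Nonempty
    · rw [sigmaStar, dif_pos hb]
      obtain ⟨s, hs, hm⟩ := mem_bottom_iff.1 (Finset.max'_mem _ hb)
      have hmax : ∀ k ∈ bottom fun j => stack Γ j w, k ≤ (bottom fun j => stack Γ j w).max' hb :=
        fun k hk => Finset.le_max' _ k hk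
      generalize (bottom fun j => stack Γ j w).max' hb = i at hm hmax ⊢
      -- The chosen bottom tile is a letter preceded only by letters missing its stick; deleting it
      -- leaves the shorter word `x ++ y`.
      obtain ⟨x, y, e, rfl, he, hx⟩ := exists_of_head?_stack hm hs
      have hdec : decide ((stack Γ i (x ++ (i, e) :: y)).head? = some 1) = e := by
        rw [hm, ← he]
        cases e <;> decide
      rw [removeBottom_stack y e hx, hdec]
      obtain ⟨h1, h2⟩ := ih (x ++ y).length (by subst hn; simp) (x ++ y) rfl
      generalize sigmaStar Γ (fun j => stack Γ j (x ++ y)) = v at h1 h2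
      have hst : ∀ k, stack Γ k ((i, e) :: v) = stack Γ k (x ++ (i, e) :: y) := by
        intro k
        by_cases hk : k = i ∨ Γ.Adj i k
        · rcases hk with rfl | hk
          · rw [stack_cons_self, h1, stack_append, stack_append, hx, stack_cons_self]
            rfl
          · rw [stack_insert_bottom_of_adj y e hx hk, stack_cons_of_adj (a := (i, e)) hk, h1]
        · rw [stack_insert_of_not x y e hk, stack_cons_of_not hk, h1]
      refine ⟨hst, fun a u hu k t ht hk => ?_⟩
      rcases List.suffix_cons_iff.1 hu with heq | hu
      · rw [heq, hst] at hk
        obtain ⟨rfl, rfl⟩ := List.cons.inj heq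
        exact hmax k (mem_bottom_iff.2 ⟨t, ht, hk⟩)
      · exact h2 a u hu k t ht hk
    · rw [sigmaStar, dif_neg hb]
      cases w with
      | nil => exact ⟨fun _ => rfl, fun a v h => by simp at h⟩
      | cons a w =>
        refine absurd ⟨a.1, mem_bottom_iff.2 ⟨bead a.2, bead_ne_zero _, ?_⟩⟩ hb
        exact congrArg List.head? (stack_cons_self a.1 a.2 w)

/-- If only the smallest letter can be moved to the front of a greedy word, then all its cyclic
permutations are greedy. -/
theorem IsGreedy.rotate {u v : Word N} (hg : IsGreedy Γ (u ++ v))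
    (hp : ∀ (k : Fin N) (s : SignType), s ≠ 0 → (stack Γ k (u ++ v)).head? = some s →
      ∀ c ∈ u ++ v, k ≤ c.1) : IsGreedy Γ (v ++ u) := by
  intro a t ht k s hs hk
  have in_u : a :: t <:+ u → k ≤ a.1 := by
    rintro ⟨r, rfl⟩
    refine hg a (t ++ v) ⟨r, by simp⟩ k s hs ?_
    rw [← List.cons_append, stack_append, List.head?_append, hk]
    rfl
  obtain ⟨r, hr⟩ := ht
  rcases List.append_eq_append_iff.1 hr with ⟨c, hv, hc⟩ | ⟨c, -, hu⟩
  · cases c with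
    | nil => exact in_u ⟨[], hc⟩
    | cons b c =>
      obtain ⟨rfl, rfl⟩ := List.cons.inj hc
      subst hv
      change (stack Γ k (a :: c ++ u)).head? = some s at hk
      rw [stack_append, List.head?_append] at hk
      cases hh : (stack Γ k (a :: c)).head? with
      | some t =>
        rw [hh, Option.some_or] at hk
        exact hg a c ⟨u ++ r, by simp⟩ k s hs (hh.trans hk)
      | none =>
        -- The sign comes from `u`, which opens `u ++ v`, so it is at the bottom of the whole
        -- `k`-stack.
        rw [hh, Option.none_or] at hk
        refine hp k s hs ?_ a (by simp)
        rw [stack_append, List.head?_append, hk]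
        rfl
  · exact in_u ⟨c, hu.symm⟩

/-! ### Cyclic stacks and cyclic reducedness -/

theorem isReduced_of_cycleChain {w : Word N}
    (hw : ∀ k, (stack Γ k w : Cycle SignType).Chain Compatible) : IsReduced Γ w := by
  refine isReduced_iff.2 fun k => ?_
  by_cases h : stack Γ k w = []
  · simp [h]
  · exact ((Cycle.chain_ne_nil _ h).1 (hw k)).tail

/-- Rotating a word rotates its stacks. -/
theorem stack_isRotated {v w : Word N} (h : v ~r w) (k : Fin N) :
    stack Γ k v ~r stack Γ k w := by
  obtain ⟨n, hn, rfl⟩ := List.isRotated_iff_mod.1 h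
  rw [List.rotate_eq_drop_append_take hn, stack_append]
  conv_lhs => rw [← List.take_append_drop n v, stack_append]
  exact List.isRotated_append

/-- Distinct commuting letters can meet the same stick only if both put a zero there. -/
theorem stack_swap {a b : Letter N} (hne : a.1 ≠ b.1) (hab : ¬ Γ.Adj a.1 b.1) (k : Fin N)
    (u v : Word N) : stack Γ k (u ++ a :: b :: v) = stack Γ k (u ++ b :: a :: v) := by
  have hba : ¬ Γ.Adj b.1 a.1 := fun h => hab h.symm
  rw [stack_append, stack_append]
  congr 1
  by_cases ha : k = a.1 ∨ Γ.Adj a.1 k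
  · by_cases hb : k = b.1 ∨ Γ.Adj b.1 k
    · have ha' : Γ.Adj a.1 k := by
        rcases ha with rfl | ha
        · rcases hb with hb | hb
          · exact absurd hb hne
          · exact absurd hb hba
        · exact ha
      have hb' : Γ.Adj b.1 k := by
        rcases hb with rfl | hb
        · exact absurd ha' hab
        · exact hb
      rw [stack_cons_of_adj ha', stack_cons_of_adj hb', stack_cons_of_adj hb',
        stack_cons_of_adj ha']
    · rw [stack_cons_of_not hb]
      simp only [stack, List.filterMap_cons, mark_of_not hb]
  · rw [stack_cons_of_not ha]
    simp only [stack, List.filterMap_cons, mark_of_not ha]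

/-- Cyclings and commutations do not create consecutive opposite signs in the cyclic stacks. -/
theorem cycleChain_of_move {v w : Word N} (h : Move Γ v w)
    (hv : ∀ k, (stack Γ k v : Cycle SignType).Chain Compatible) (k : Fin N) :
    (stack Γ k w : Cycle SignType).Chain Compatible := by
  cases h with
  | cycling a w =>
    rw [← Cycle.coe_eq_coe.2 (stack_isRotated (List.isRotated_append (l := [a]) (l' := w)) k)]
    exact hv k
  | commutation u v a b hab =>
    by_cases hne : a.1 = b.1
    · by_cases h2 : a.2 = b.2
      · rw [Prod.ext hne h2] at hv ⊢
        exact hv k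
      · refine absurd ⟨u, [], v, a.1, a.2, ?_, by simp⟩ (isReduced_of_cycleChain hv)
        have : b = (a.1, !a.2) :=
          Prod.ext hne.symm (by revert h2; cases a.2 <;> cases b.2 <;> simp)
        rw [this]
        simp
    · rw [← stack_swap hne hab]
      exact hv k

theorem isCyclicallyReducedWord_of_cycleChain {w : Word N}
    (hw : ∀ k, (stack Γ k w : Cycle SignType).Chain Compatible) :
    IsCyclicallyReducedWord Γ w := by
  intro v hv
  refine isReduced_of_cycleChain ?_
  induction hv with
  | refl => exact hw
  | tail _ h ih => exact cycleChain_of_move h ih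

/-- The only link not already in the linear stack joins its last bead to its first. -/
theorem cycleChain_of_isReduced {w : Word N} (hw : IsReduced Γ w)
    (hc : IsCyclicallyReduced fun k => stack Γ k w) (k : Fin N) :
    (stack Γ k w : Cycle SignType).Chain Compatible := by
  by_cases h : stack Γ k w = []
  · rw [h]
    exact Cycle.Chain.nil _
  · rw [Cycle.chain_ne_nil _ h, List.isChain_cons]
    refine ⟨fun t ht hs hts => hc ⟨k, t, ?_, ht, ?_⟩, isReduced_iff.1 hw k⟩
    · simpa [hts] using hs
    · rw [hts, neg_neg, List.getLast?_eq_some_getLast h]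

end Stacks

end RAAG

theorem propositionT {N : ℕ} (Γ : SimpleGraph (Fin N)) [DecidableRel Γ.Adj]
    (p : RAAG.AbstractPiling N) (hp : RAAG.IsPiling Γ p)
    (hns : RAAG.IsNonSplit Γ p) (hcr : RAAG.IsCyclicallyReduced p)
    (hpyr : RAAG.IsPyramidal p) :
    RAAG.IsCyclicNormalForm Γ (RAAG.sigmaStar Γ p) := by
  open RAAG in
  obtain ⟨w₀, hw₀, rfl⟩ := hp.isReducedPiling
  obtain ⟨hst, hg⟩ := sigmaStar_stack (Γ := Γ) w₀
  generalize sigmaStar Γ (fun j => stack Γ j w₀) = w at hst hg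
  have hst' : (fun j => stack Γ j w₀) = fun j => stack Γ j w := funext fun j => (hst j).symm
  rw [hst'] at hcr hpyr
  have hw : IsReduced Γ w := isReduced_iff.2 fun k => by
    rw [hst]
    exact isReduced_iff.1 hw₀ k
  have hcyc := cycleChain_of_isReduced hw hcr
  refine ⟨hw, isCyclicallyReducedWord_of_cycleChain hcyc, hg.isNormal hw, fun v hv => ?_⟩
  have hvr : IsReduced Γ v := isReduced_of_cycleChain fun k => by
    rw [Cycle.coe_eq_coe.2 (stack_isRotated hv k)]
    exact hcyc k
  refine IsGreedy.isNormal ?_ hvr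
  obtain ⟨i, hi, hpyr⟩ := hpyr
  obtain ⟨n, hn, rfl⟩ := List.isRotated_iff_mod.1 hv.symm
  rw [List.rotate_eq_drop_append_take hn]
  apply IsGreedy.rotate <;> rw [List.take_append_drop]
  · exact hg
  · intro k s hs hk c hc
    -- Pyramidality: only the apex stack can start with a sign, and its index is least in the
    -- support.
    have hki : k = i := by
      by_contra hne
      rcases hpyr k hne with h | h <;> dsimp only at h
      · rw [h] at hk
        exact absurd hk (by simp)
      · exact hs (Option.some.inj (hk.symm.trans h))
    rw [hki]
    exact hi.2 (mem_support_stack_iff.2 ⟨c.2, hc⟩)
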